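/- Let $T_2=\{0,1\}^*$ be the complete binary-branching tree domain, with the relations parent ($u\triangleleft ui$), domination ($u\triangleleft^* uv$) and left-of ($uiv\prec ujw$ whenever $i<j$). For an equivalence relation $\mathrm{CI}$ on $T_2$ let $\mathcal T_{\mathrm{CI}}=\langle T_2,\triangleleft,\triangleleft^*,\prec,\mathrm{CI}\rangle$, and let S2S+CI be the monadic second-order theory of the class of all these structures, i.e. the set of monadic second-order sentences in the symbols $\triangleleft,\triangleleft^*,\prec,\approx$ and $\mathrm{CI}$ (with individual variables and set variables) that are true in $\mathcal T_{\mathrm{CI}}$ for every equivalence relation $\mathrm{CI}$ on $T_2$. For countable sets $K$ of individual constants and $P$ of monadic predicate constants let $L^2_{K,P}$ be the monadic second-order language with these constants and the binary predicates $\triangleleft,\triangleleft^*,\prec,\approx$ (so without $\mathrm{CI}$). **Theorem.** (1) S2S+CI is undecidable: the set of Gödel numbers of its members is not recursive. (2) Free indexation is not definable in $L^2_{K,P}$: for no countable $K$ and $P$ is there a formula $\varphi(x,y)$ of $L^2_{K,P}$, with no free variables other than the individual variables $x,y$, such that every equivalence relation on $T_2$ is the relation $\{(a,b)\in T_2^2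 : T_2\models\varphi[a,b]\}$ for some interpretation of the constants in $K$ and $P$ by nodes and sets of nodes of $T_2$. -/

import Mathlib

namespace MSOTree

/-! ### Syntax of monadic second-order logic over trees -/

/-- Individual terms: individual variables `x₀, x₁, …` and individual constants from `K`. -/
inductive Term (K : Type) : Type
  | var : ℕ → Term K
  | const : K → Term K

/-- Monadic second-order formulae with individual constants `K`, monadic predicate constants `P`,
the fixed binary predicates equality, parent, domination and left-of, and further binary predicate
symbols `B`.  There are countably many individual variables and countably many set variables, both
indexed by `ℕ`. -/
inductive Formula (K P B : Type) : Type
  | eq : Term K → Term K → Formula K P B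
  | parent : Term K → Term K → Formula K P B
  | dom : Term K → Term K → Formula K P B
  | leftOf : Term K → Term K → Formula K P B
  /-- `rel b s t`: the binary predicate symbol `b` holds of `s, t`. -/
  | rel : B → Term K → Term K → Formula K P B
  /-- `pred p t`: the monadic predicate constant `p` holds of `t`. -/
  | pred : P → Term K → Formula K P B
  /-- `mem X t`: the set variable with index `X` contains `t`. -/
  | mem : ℕ → Term K → Formula K P B
  | neg : Formula K P B → Formula K P B
  | and : Formula K P B → Formula K P B → Formula K P B
  /-- `exInd x φ`: there is an individual `x` with `φ`. -/
  | exInd : ℕ → Formula K P B → Formula K P B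
  /-- `exSet X φ`: there is a set `X` of individuals with `φ`. -/
  | exSet : ℕ → Formula K P B → Formula K P B

/-- The language `L²_{K,P}`: no binary predicates besides the fixed ones. -/
abbrev L2 (K P : Type) : Type := Formula K P Empty

/-- The language of the binary tree with the one additional binary predicate symbol `CI`. -/
abbrev LCI : Type := Formula Empty Empty Unit

namespace Term

/-- The individual variables of a term. -/
def vars {K : Type} : Term K → Set ℕ
  | var x => {x}
  | const _ => ∅

/-- Gödel number of a term. -/
def code {K : Type} [Encodable K] : Term K → ℕ
  | var x => Nat.pair 0 x
  | const k => Nat.pair 1 (Encodable.encode k)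

theorem code_injective {K : Type} [Encodable K] :
    Function.Injective (code : Term K → ℕ) := by
  intro s t h
  cases s <;> cases t <;> simp_all [code, Nat.pair_eq_pair]

end Term

namespace Formula

variable {K P B : Type}

/-! Proper domination and the remaining connectives and quantifiers are defined as usual. -/

def pdom (s t : Term K) : Formula K P B := (dom s t).and (eq s t).neg
def or (φ ψ : Formula K P B) : Formula K P B := (φ.neg.and ψ.neg).neg
def imp (φ ψ : Formula K P B) : Formula K P B := (φ.and ψ.neg).neg
def iff (φ ψ : Formula K P B) : Formula K P B := (imp φ ψ).and (imp ψ φ)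
def allInd (x : ℕ) (φ : Formula K P B) : Formula K P B := (exInd x φ.neg).neg
def allSet (X : ℕ) (φ : Formula K P B) : Formula K P B := (exSet X φ.neg).neg

/-- The individual variables that occur free. -/
def freeInd : Formula K P B → Set ℕ
  | eq s t => s.vars ∪ t.vars
  | parent s t => s.vars ∪ t.vars
  | dom s t => s.vars ∪ t.vars
  | leftOf s t => s.vars ∪ t.vars
  | rel _ s t => s.vars ∪ t.vars
  | pred _ t => t.vars
  | mem _ t => t.vars
  | neg φ => φ.freeInd
  | and φ ψ => φ.freeInd ∪ ψ.freeInd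
  | exInd x φ => φ.freeInd \ {x}
  | exSet _ φ => φ.freeInd

/-- The set variables that occur free. -/
def freeSet : Formula K P B → Set ℕ
  | eq _ _ => ∅
  | parent _ _ => ∅
  | dom _ _ => ∅
  | leftOf _ _ => ∅
  | rel _ _ _ => ∅
  | pred _ _ => ∅
  | mem X _ => {X}
  | neg φ => φ.freeSet
  | and φ ψ => φ.freeSet ∪ ψ.freeSet
  | exInd _ φ => φ.freeSet
  | exSet X φ => φ.freeSet \ {X}

/-- A sentence is a formula without free variables. -/
def IsSentence (φ : Formula K P B) : Prop := φ.freeInd = ∅ ∧ φ.freeSet = ∅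

/-- Gödel number of a formula. -/
def code [Encodable K] [Encodable P] [Encodable B] : Formula K P B → ℕ
  | eq s t => Nat.pair 0 (Nat.pair s.code t.code)
  | parent s t => Nat.pair 1 (Nat.pair s.code t.code)
  | dom s t => Nat.pair 2 (Nat.pair s.code t.code)
  | leftOf s t => Nat.pair 3 (Nat.pair s.code t.code)
  | rel b s t => Nat.pair 4 (Nat.pair (Encodable.encode b) (Nat.pair s.code t.code))
  | pred p t => Nat.pair 5 (Nat.pair (Encodable.encode p) t.code)
  | mem X t => Nat.pair 6 (Nat.pair X t.code)
  | neg φ => Nat.pair 7 φ.code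
  | and φ ψ => Nat.pair 8 (Nat.pair φ.code ψ.code)
  | exInd x φ => Nat.pair 9 (Nat.pair x φ.code)
  | exSet X φ => Nat.pair 10 (Nat.pair X φ.code)

theorem code_injective [Encodable K] [Encodable P] [Encodable B] :
    Function.Injective (code : Formula K P B → ℕ) := by
  intro φ
  induction φ with
  | neg φ ih =>
    intro ψ h
    cases ψ <;> simp [code, Nat.pair_eq_pair] at h
    rw [ih h]
  | and φ₁ φ₂ ih₁ ih₂ =>
    intro ψ h
    cases ψ <;> simp [code, Nat.pair_eq_pair] at h
    rw [ih₁ h.1, ih₂ h.2]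
  | exInd x φ ih =>
    intro ψ h
    cases ψ <;> simp [code, Nat.pair_eq_pair] at h
    rw [h.1, ih h.2]
  | exSet x φ ih =>
    intro ψ h
    cases ψ <;> simp [code, Nat.pair_eq_pair] at h
    rw [h.1, ih h.2]
  | _ =>
    intro ψ h
    cases ψ <;> simp [code, Nat.pair_eq_pair, Term.code_injective.eq_iff] at h <;> simp [h]

end Formula

/-! ### Semantics -/

/-- Structures with universe `U` for the language with constants `K`, `P`, `B`. -/
structure Model (K P B U : Type) where
  ind : K → U
  pred : P → Set U
  parent : U → U → Prop
  dom : U → U → Prop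
  leftOf : U → U → Prop
  rel : B → U → U → Prop

/-- The value of a term under an assignment `s` of the individual variables. -/
def Term.val {K P B U : Type} (M : Model K P B U) (s : ℕ → U) : Term K → U
  | var x => s x
  | const k => M.ind k

/-- `φ.Sat M s S`: the structure `M` satisfies `φ` under the assignment `s` of individuals to the
individual variables and `S` of sets of individuals to the set variables. -/
def Formula.Sat {K P B U : Type} (M : Model K P B U) :
    Formula K P B → (ℕ → U) → (ℕ → Set U) → Prop
  | eq a b, s, _ => a.val M s = b.val M s
  | parent a b, s, _ => M.parent (a.val M s) (b.val M s)
  | dom a b, s, _ => M.dom (a.val M s) (b.val M s)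
  | leftOf a b, s, _ => M.leftOf (a.val M s) (b.val M s)
  | rel r a b, s, _ => M.rel r (a.val M s) (b.val M s)
  | pred p a, s, _ => a.val M s ∈ M.pred p
  | mem X a, s, S => a.val M s ∈ S X
  | neg φ, s, S => ¬ φ.Sat M s S
  | and φ ψ, s, S => φ.Sat M s S ∧ ψ.Sat M s S
  | exInd x φ, s, S => ∃ u : U, φ.Sat M (Function.update s x u) S
  | exSet X φ, s, S => ∃ A : Set U, φ.Sat M s (Function.update S X A)

/-! ### The complete binary tree -/

/-- The complete binary-branching tree domain `{0,1}*`; `[]` is the root, and the children of `w`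
are `w ++ [0]` (left) and `w ++ [1]` (right). -/
abbrev T2 : Type := List (Fin 2)

/-- The complete binary tree with its natural parent, domination and left-of relations, expanded
by interpretations of the constants in `K`, `P` and `B`. -/
def treeModel {K P B : Type} (I : K → T2) (R : P → Set T2) (C : B → T2 → T2 → Prop) :
    Model K P B T2 where
  ind := I
  pred := R
  parent := fun u v => ∃ i : Fin 2, v = u ++ [i]
  dom := fun u v => ∃ w : T2, v = u ++ w
  leftOf := fun a b => ∃ (u v w : T2) (i j : Fin 2), i < j ∧ a = u ++ [i] ++ v ∧ b = u ++ [j] ++ w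
  rel := C

/-- The structure `⟨T₂, parent, domination, left-of, CI⟩`. -/
def treeCI (CI : T2 → T2 → Prop) : Model Empty Empty Unit T2 :=
  treeModel Empty.elim Empty.elim (fun _ => CI)

/-! ### The theory S2S+CI, decidability, definability -/

/-- S2S+CI: the set of monadic second-order sentences that are true in every structure
`⟨T₂, parent, domination, left-of, CI⟩` in which `CI` is an equivalence relation. -/
def S2SCI : Set LCI :=
  {φ | φ.IsSentence ∧ ∀ CI : T2 → T2 → Prop, Equivalence CI → ∀ s S, φ.Sat (treeCI CI) s S}

/-- A set of sentences is decidable if the set of Gödel numbers of its members is recursive. -/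
def DecidableTheory {K P B : Type} [Encodable K] [Encodable P] [Encodable B]
    (Γ : Set (Formula K P B)) : Prop :=
  ComputablePred fun n : ℕ => n ∈ Formula.code '' Γ

/-- The formula `φ(x₀, x₁)` of `L²_{K,P}` defines the binary relation `CI` on the binary tree whose
constants are interpreted by `I` and `R`. -/
def Defines {K P : Type} (φ : L2 K P) (I : K → T2) (R : P → Set T2) (CI : T2 → T2 → Prop) : Prop :=
  ∀ (s : ℕ → T2) (S : ℕ → Set T2),
    φ.Sat (treeModel I R (fun b : Empty => b.elim)) s S ↔ CI (s 0) (s 1)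

/-- Free indexation (the free choice of an arbitrary equivalence relation on the nodes) is definable
by a formula of `L²_{K,P}` on the binary tree: some `φ(x₀, x₁)`, with no other free variables,
defines each equivalence relation under a suitable interpretation of the constants. -/
def FreeIndexationDefinable (K P : Type) : Prop :=
  ∃ φ : L2 K P, φ.freeInd ⊆ {0, 1} ∧ φ.freeSet = ∅ ∧
    ∀ CI : T2 → T2 → Prop, Equivalence CI →
      ∃ (I : K → T2) (R : P → Set T2), Defines φ I R CI

end MSOTree

/-! Undefinability is a composition argument. Fix a formula and an interpretation of the constants.
By induction on the formula, its truth value depends on the part of the assignment inside the left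
subtree only through finitely many types (`finitelyTyped_sat`). The equivalence relation that pairs
`0w` with `1w` needs infinitely many: as `w` varies, some two nodes `0w` have the same type, and
exchanging them while `1w` stays fixed preserves truth but breaks the pairing.

For undecidability one equivalence relation suffices, that of equal length, and a single sentence
`levelAxiom` singles it out among all equivalence relations (`sat_levelAxiom_iff`). In the resulting
tree a node stands for its length, and a node `w` also codes the pair of its number of leading zeros
and its length, so set quantifiers yield quantifiers over arbitrary binary relations on the naturals
(`NatDef.exRel`). With these, definitions by recursion become explicit, and the graph of every
partial recursive function is definable (`NatDef.mem_partrec`). Halting on input 0 is then a formula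
about the level of a node, and conditioning on `levelAxiom` turns each instance into a sentence
whose validity is equivalent to it (`Formula.sat_atLevel_iff`). -/

namespace MSOTree

/-! ### Undefinability of free indexation

For every formula, the dependence of its truth value on the part of the assignment that lies in
the subtree below the left child of the root is captured by finitely many types. -/

/-- The node is dominated by the left child of the root. -/
def InLeft (u : T2) : Prop := u.head? = some 0

open Classical in
/-- Collapse everything outside the left subtree to the root. -/
noncomputable def leftPart (u : T2) : T2 := if InLeft u then u else []

theorem not_inLeft_nil : ¬ InLeft [] := by simp [InLeft]

theorem leftPart_of_inLeft {u : T2} (h : InLeft u) : leftPart u = u := if_pos h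

theorem leftPart_of_not_inLeft {u : T2} (h : ¬ InLeft u) : leftPart u = [] := if_neg h

theorem inLeft_append {u v : T2} (h : InLeft u) : InLeft (u ++ v) := by
  cases u <;> simp_all [InLeft]

/-- The assignments agree outside the left subtree. -/
def AgreeOff (s s' : ℕ → T2) (S S' : ℕ → Set T2) : Prop :=
  (∀ n, s n = s' n ∨ (InLeft (s n) ∧ InLeft (s' n))) ∧ ∀ n u, ¬ InLeft u → (u ∈ S n ↔ u ∈ S' n)

theorem AgreeOff.symm {s s' : ℕ → T2} {S S' : ℕ → Set T2} (h : AgreeOff s s' S S') :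
    AgreeOff s' s S' S :=
  ⟨fun n => (h.1 n).imp Eq.symm And.symm, fun n u hu => (h.2 n u hu).symm⟩

theorem AgreeOff.val {K P B : Type} {M : Model K P B T2} {s s' : ℕ → T2} {S S' : ℕ → Set T2}
    (h : AgreeOff s s' S S') (a : Term K) :
    a.val M s = a.val M s' ∨ (InLeft (a.val M s) ∧ InLeft (a.val M s')) := by
  cases a with
  | var x => exact h.1 x
  | const k => exact Or.inl rfl

theorem val_leftPart {K P B : Type} {M : Model K P B T2} {s : ℕ → T2} {a : Term K}
    (h : InLeft (a.val M s)) : a.val M (leftPart ∘ s) = a.val M s := by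
  cases a with
  | var x => exact leftPart_of_inLeft h
  | const k => rfl

/-- The set of truth-relevant types of the left part of an assignment is finite. -/
def FinitelyTyped (p : (ℕ → T2) → (ℕ → Set T2) → Prop) : Prop :=
  ∃ (F : Type) (_ : Finite F) (f : (ℕ → T2) → (ℕ → Set T2) → F), ∀ s s' S S',
    AgreeOff s s' S S' →
    f (leftPart ∘ s) (fun n => S n ∩ {u | InLeft u}) =
      f (leftPart ∘ s') (fun n => S' n ∩ {u | InLeft u}) → p s S → p s' S'

/-- Two inside values survive the collapse, so the type can record the truth value itself. In the
mixed cases the relation cannot tell inside nodes apart, except that a right argument may be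
recognised as `[0]`, the only inside node whose parent is outside. -/
theorem finitelyTyped_binary {K P B : Type} (M : Model K P B T2) (a b : Term K)
    (ρ : T2 → T2 → Prop)
    (h₁ : ∀ u u' v, InLeft u → InLeft u' → ¬ InLeft v → ρ u v → ρ u' v)
    (h₂ : ∀ u v v', ¬ InLeft u → InLeft v → InLeft v' → (v = [0] ↔ v' = [0]) → ρ u v → ρ u v') :
    FinitelyTyped fun s _ => ρ (a.val M s) (b.val M s) := by
  refine ⟨Prop × Prop, inferInstance,
    fun s _ => (ρ (a.val M s) (b.val M s), b.val M s = [0]), ?_⟩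
  intro s s' S S' h hf hs
  simp only [Prod.mk.injEq, eq_iff_iff] at hf
  have ha := h.val (M := M) a
  have hb := h.val (M := M) b
  by_cases hu : InLeft (a.val M s) <;> by_cases hv : InLeft (b.val M s)
  · have hu' : InLeft (a.val M s') := ha.elim (fun e => e ▸ hu) And.right
    have hv' : InLeft (b.val M s') := hb.elim (fun e => e ▸ hv) And.right
    rw [val_leftPart hu, val_leftPart hv, val_leftPart hu', val_leftPart hv'] at hf
    exact hf.1.1 hs
  · have hu' : InLeft (a.val M s') := ha.elim (fun e => e ▸ hu) And.right
    have e : b.val M s = b.val M s' := hb.resolve_right fun h => hv h.1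
    rw [← e]
    exact h₁ _ _ _ hu hu' hv hs
  · have e : a.val M s = a.val M s' := ha.resolve_right fun h => hu h.1
    have hv' : InLeft (b.val M s') := hb.elim (fun e => e ▸ hv) And.right
    rw [val_leftPart hv, val_leftPart hv'] at hf
    rw [← e]
    exact h₂ _ _ _ hu hv hv' hf.2 hs
  · have e : a.val M s = a.val M s' := ha.resolve_right fun h => hu h.1
    have e' : b.val M s = b.val M s' := hb.resolve_right fun h => hv h.1
    rwa [← e, ← e']

/-- Each quantifier replaces the type set by, essentially, its power set: the new type is the set of
old types reachable by some choice of inside part. Finiteness is thus preserved. -/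
theorem finitelyTyped_sat {K P : Type} (I : K → T2) (R : P → Set T2) (φ : L2 K P) :
    FinitelyTyped (φ.Sat (treeModel I R fun b : Empty => b.elim)) := by
  induction φ with
  | eq a b =>
    refine finitelyTyped_binary _ a b (fun u v => u = v) ?_ ?_
    · rintro u u' v hu - hv rfl; exact absurd hu hv
    · rintro u v v' hu hv - - rfl; exact absurd hv hu
  | parent a b =>
    refine finitelyTyped_binary _ a b (fun u v => ∃ i : Fin 2, v = u ++ [i]) ?_ ?_
    · rintro u u' v hu - hv ⟨i, rfl⟩; exact absurd (inLeft_append hu) hv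
    · rintro u v v' hu hv hv' he ⟨i, rfl⟩
      cases u with
      | nil =>
        have : i = 0 := by simpa [InLeft] using hv
        subst this
        exact ⟨0, he.1 rfl⟩
      | cons c u => simp_all [InLeft]
  | dom a b =>
    refine finitelyTyped_binary _ a b (fun u v => ∃ w : T2, v = u ++ w) ?_ ?_
    · rintro u u' v hu - hv ⟨i, rfl⟩; exact absurd (inLeft_append hu) hv
    · rintro u v v' hu hv hv' - ⟨w, rfl⟩
      cases u with
      | nil => exact ⟨v', rfl⟩
      | cons c u => simp_all [InLeft]
  | leftOf a b =>
    refine finitelyTyped_binary _ a b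
      (fun a b => ∃ (u v w : T2) (i j : Fin 2), i < j ∧ a = u ++ [i] ++ v ∧ b = u ++ [j] ++ w) ?_ ?_
    · rintro u u' v hu hu' hv ⟨c, d, e, i, j, hij, rfl, rfl⟩
      cases c with
      | nil =>
        cases u' with
        | nil => exact absurd hu' not_inLeft_nil
        | cons k u' =>
          have : k = 0 := by simpa [InLeft] using hu'
          have h0 : i = 0 := by simpa [InLeft] using hu
          exact ⟨[], u', e, 0, j, h0 ▸ hij, by simp [this], rfl⟩
      | cons c u => simp_all [InLeft]
    · rintro u v v' hu hv hv' - ⟨c, d, e, i, j, hij, rfl, rfl⟩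
      cases c with
      | nil =>
        have : j = 0 := by simpa [InLeft] using hv
        subst this
        exact absurd hij (by simp)
      | cons c u => simp_all [InLeft]
  | rel b => exact b.elim
  | pred p a =>
    refine ⟨Prop, inferInstance, fun s _ => a.val (treeModel I R fun b : Empty => b.elim) s ∈ R p,
      fun s s' S S' h hf hs => ?_⟩
    rcases h.val (M := treeModel I R fun b : Empty => b.elim) a with e | ⟨hu, hu'⟩
    · exact (congrArg (· ∈ R p) e).mp hs
    · simp only [val_leftPart hu, val_leftPart hu'] at hf
      exact hf.mp hs
  | mem X a =>
    refine ⟨Prop, inferInstance, fun s S => a.val (treeModel I R fun b : Empty => b.elim) s ∈ S X,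
      fun s s' S S' h hf hs => ?_⟩
    by_cases hu : InLeft (a.val (treeModel I R fun b : Empty => b.elim) s)
    · have hu' := (h.val (M := treeModel I R fun b : Empty => b.elim) a).elim
        (fun e => e ▸ hu) And.right
      simp only [val_leftPart hu, val_leftPart hu'] at hf
      exact (hf.mp ⟨hs, hu⟩).1
    · have e := (h.val (M := treeModel I R fun b : Empty => b.elim) a).resolve_right
        fun h => hu h.1
      exact (congrArg (· ∈ S' X) e).mp ((h.2 X _ hu).1 hs)
  | neg φ ih =>
    obtain ⟨F, hF, f, h⟩ := ih
    exact ⟨F, hF, f, fun s s' S S' ha hf hs hs' => hs (h s' s S' S ha.symm hf.symm hs')⟩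
  | and φ ψ ih₁ ih₂ =>
    obtain ⟨F, hF, f, hf⟩ := ih₁
    obtain ⟨G, hG, g, hg⟩ := ih₂
    refine ⟨F × G, inferInstance, fun s S => (f s S, g s S), fun s s' S S' ha he hs => ?_⟩
    rw [Prod.mk.injEq] at he
    exact ⟨hf s s' S S' ha he.1 hs.1, hg s s' S S' ha he.2 hs.2⟩
  | exInd x φ ih =>
    obtain ⟨F, hF, f, h⟩ := ih
    -- The first component lists the types for inside witnesses; the second is the type for any
    -- outside witness, since all of these collapse to the root.
    refine ⟨Set F × F, inferInstance, fun s S =>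
      ((fun u => f (Function.update s x u) S) '' {u | InLeft u}, f (Function.update s x []) S), ?_⟩
    rintro s s' S S' ha he ⟨u, hu⟩
    rw [Prod.mk.injEq] at he
    by_cases hl : InLeft u
    · obtain ⟨u', hu', e⟩ := he.1.le ⟨u, hl, rfl⟩
      refine ⟨u', h _ _ _ _ ⟨fun n => ?_, ha.2⟩ ?_ hu⟩
      · by_cases hn : n = x
        · subst hn; simpa using Or.inr ⟨hl, hu'⟩
        · simpa [hn] using ha.1 n
      · rw [Function.comp_update, Function.comp_update, leftPart_of_inLeft hl,
          leftPart_of_inLeft hu']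
        exact e.symm
    · refine ⟨u, h _ _ _ _ ⟨fun n => ?_, ha.2⟩ ?_ hu⟩
      · by_cases hn : n = x
        · subst hn; simp
        · simpa [hn] using ha.1 n
      · rw [Function.comp_update, Function.comp_update, leftPart_of_not_inLeft hl]
        exact he.2
  | exSet X φ ih =>
    obtain ⟨F, hF, f, h⟩ := ih
    have upd (S : ℕ → Set T2) (C : Set T2) :
        (fun n => Function.update S X C n ∩ {u | InLeft u}) =
          Function.update (fun n => S n ∩ {u | InLeft u}) X (C ∩ {u | InLeft u}) := by
      funext n
      by_cases hn : n = X
      · subst hn; simp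
      · simp [hn]
    refine ⟨Set F, inferInstance, fun s S =>
      Set.range fun C : Set T2 => f s (Function.update S X (C ∩ {u | InLeft u})), ?_⟩
    rintro s s' S S' ha he ⟨C, hC⟩
    obtain ⟨D, e⟩ := he.le ⟨C, rfl⟩
    -- Glue: the inside part comes from the matching witness `D`, the outside part from the original
    -- `C`.
    refine ⟨D ∩ {u | InLeft u} ∪ C \ {u | InLeft u}, h _ _ _ _ ⟨ha.1, fun n u hu => ?_⟩ ?_ hC⟩
    · by_cases hn : n = X
      · subst hn; simp [hu]
      · simpa [hn] using ha.2 n u hu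
    · rw [upd, upd]
      refine e.symm.trans (congrArg (f _) (congrArg _ ?_))
      ext u
      simp only [Set.mem_inter_iff, Set.mem_union, Set.mem_sdiff, Set.mem_ofPred_eq]
      tauto

theorem not_freeIndexationDefinable (K P : Type) : ¬ FreeIndexationDefinable K P := by
  rintro ⟨φ, -, -, h⟩
  -- The classes are `{0w, 1w}` and the root alone; the first conjunct is there because `[]` and
  -- `[0]` have the same tail.
  obtain ⟨I, R, hφ⟩ := h (fun u v => (u = [] ↔ v = []) ∧ u.tail = v.tail)
    ⟨fun _ => ⟨Iff.rfl, rfl⟩, fun h => ⟨h.1.symm, h.2.symm⟩,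
      fun h h' => ⟨h.1.trans h'.1, h.2.trans h'.2⟩⟩
  obtain ⟨F, hF, f, hf⟩ := finitelyTyped_sat I R φ
  let S : ℕ → Set T2 := fun _ => ∅
  let s (i j n : ℕ) : T2 := if n = 0 then 0 :: List.replicate i 0 else 1 :: List.replicate j 0
  -- Pigeonhole on the types of the nodes `0 0^i`. The node `1 0^j` is outside, so its exponent, set
  -- to 0 here, does not affect the type.
  obtain ⟨i, j, hij, he⟩ := Finite.exists_ne_map_eq_of_infinite fun i =>
    f (leftPart ∘ s i 0) fun n => S n ∩ {u | InLeft u}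
  have hs (i j) : leftPart ∘ s i j = leftPart ∘ s i 0 := by
    funext n
    by_cases hn : n = 0 <;> simp [s, hn, leftPart, InLeft]
  have hsat := (hφ (s i i) S).2 (by simp [s])
  have := hf (s i i) (s j i) S S ⟨fun n => ?_, fun _ _ _ => Iff.rfl⟩ (by rw [hs i i, hs j i]; exact he)
    hsat
  · have := ((hφ (s j i) S).1 this).2
    simp [s] at this
    exact hij this.symm
  · by_cases hn : n = 0 <;> simp [s, hn, InLeft]


/-! ### The tree with the equal-level relation -/

/-- The binary tree in which `CI` relates the nodes of the same length. -/
def levelModel : Model Empty Empty Unit T2 := treeCI fun u v => u.length = v.length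

/-- The predicate on assignments is defined by a formula over the tree with equal level. -/
def TreeDef (p : (ℕ → T2) → (ℕ → Set T2) → Prop) : Prop :=
  ∃ φ : LCI, ∀ s S, φ.Sat levelModel s S ↔ p s S

/-- The number of zeros that a node starts with. -/
def leadingZeros (w : T2) : ℕ := (w.takeWhile (· == 0)).length

/-- The witness `z` is the longest initial segment of `w` on the leftmost branch. The right side
uses only length comparison, domination and membership in that branch, all definable. -/
theorem leadingZeros_eq_iff (w : T2) (n : ℕ) : leadingZeros w = n ↔
    ∃ z : T2, z.length = n ∧ 1 ∉ z ∧ z <+: w ∧ ¬ ∃ y : T2, 1 ∉ y ∧ y <+: w ∧ ¬ y <+: z := by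
  have hz : ∀ c : Fin 2, c ≠ 1 ↔ c = 0 := by decide
  have h1 : (1 : Fin 2) ∉ w.takeWhile (· == 0) := fun h => by
    simpa using List.mem_takeWhile_imp h
  have h2 (y : T2) (hy : 1 ∉ y) (hw : y <+: w) : y <+: w.takeWhile (· == 0) := by
    obtain ⟨t, rfl⟩ := hw
    rw [List.takeWhile_append_of_pos]
    · exact List.prefix_append _ _
    · intro c hc
      simpa using (hz c).1 fun h => hy (h ▸ hc)
  constructor
  · rintro rfl
    exact ⟨_, rfl, h1, List.takeWhile_prefix _, fun ⟨y, hy, hw, h⟩ => h (h2 y hy hw)⟩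
  · rintro ⟨z, rfl, hz1, hzw, hmax⟩
    have h3 : w.takeWhile (· == 0) <+: z := by
      by_contra h
      exact hmax ⟨_, h1, List.takeWhile_prefix _, h⟩
    exact le_antisymm h3.length_le (h2 z hz1 hzw).length_le

namespace TreeDef

variable {p q : (ℕ → T2) → (ℕ → Set T2) → Prop}

theorem congr (hp : TreeDef p) (h : ∀ s S, p s S ↔ q s S) : TreeDef q :=
  hp.imp fun _ hφ s S => (hφ s S).trans (h s S)

theorem not (hp : TreeDef p) : TreeDef fun s S => ¬ p s S := by
  obtain ⟨φ, hφ⟩ := hp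
  exact ⟨φ.neg, fun s S => not_congr (hφ s S)⟩

theorem and (hp : TreeDef p) (hq : TreeDef q) : TreeDef fun s S => p s S ∧ q s S := by
  obtain ⟨φ, hφ⟩ := hp
  obtain ⟨ψ, hψ⟩ := hq
  exact ⟨φ.and ψ, fun s S => and_congr (hφ s S) (hψ s S)⟩

theorem or (hp : TreeDef p) (hq : TreeDef q) : TreeDef fun s S => p s S ∨ q s S :=
  (hp.not.and hq.not).not.congr fun s S => by tauto

theorem exInd (x : ℕ) (hp : TreeDef p) :
    TreeDef fun s S => ∃ u, p (Function.update s x u) S := by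
  obtain ⟨φ, hφ⟩ := hp
  exact ⟨φ.exInd x, fun s S => exists_congr fun u => hφ _ _⟩

theorem exSet (X : ℕ) (hp : TreeDef p) :
    TreeDef fun s S => ∃ A, p s (Function.update S X A) := by
  obtain ⟨φ, hφ⟩ := hp
  exact ⟨φ.exSet X, fun s S => exists_congr fun u => hφ _ _⟩

theorem dom (i j : ℕ) : TreeDef fun s _ => s i <+: s j :=
  ⟨.dom (.var i) (.var j), fun _ _ => exists_congr fun _ => eq_comm⟩

theorem parent (i j : ℕ) : TreeDef fun s _ => ∃ k : Fin 2, s j = s i ++ [k] :=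
  ⟨.parent (.var i) (.var j), fun _ _ => Iff.rfl⟩

theorem sameLevel (i j : ℕ) : TreeDef fun s _ => (s i).length = (s j).length :=
  ⟨.rel () (.var i) (.var j), fun _ _ => Iff.rfl⟩

theorem mem (i X : ℕ) : TreeDef fun s S => s i ∈ S X :=
  ⟨.mem X (.var i), fun _ _ => Iff.rfl⟩

/-- A node is on the leftmost branch iff nothing is to the left of it. -/
theorem leftmost (i : ℕ) : TreeDef fun s _ => 1 ∉ s i := by
  refine ⟨((Formula.leftOf (.var (i + 1)) (.var i)).exInd (i + 1)).neg, fun s S =>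
    not_congr ⟨?_, fun h => ?_⟩⟩
  · rintro ⟨t, u, v, w, a, b, hab, -, h⟩
    have h : s i = u ++ [b] ++ w := by simpa [Term.val] using h
    have : b = 1 := by omega
    simp [h, this]
  · obtain ⟨u, w, h⟩ := List.append_of_mem h
    exact ⟨u ++ [0], u, [], w, 0, 1, by simp, by simp [Term.val], by simp [Term.val, h]⟩

theorem leadingZeros (i j : ℕ) :
    TreeDef fun s _ => MSOTree.leadingZeros (s j) = (s i).length := by
  -- Indices above `i + j` are fresh bound variables.
  have h := exInd (i + j + 1) <| (sameLevel (i + j + 1) i).and <| (leftmost (i + j + 1)).and <|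
    (dom (i + j + 1) j).and <| not <| exInd (i + j + 2) <| (leftmost (i + j + 2)).and <|
    (dom (i + j + 2) j).and <| (dom (i + j + 2) (i + j + 1)).not
  refine h.congr fun s S => ?_
  simp (disch := omega) only [Function.update_self, Function.update_of_ne]
  exact (leadingZeros_eq_iff _ _).symm

end TreeDef

/-! ### Second-order logic of the natural numbers inside the tree -/

/-- The binary relation on numbers coded by two sets of nodes. -/
def codedRel (X Y : Set T2) (a b : ℕ) : Prop :=
  (∃ w ∈ X, leadingZeros w = a ∧ w.length = b) ∨ ∃ w ∈ Y, leadingZeros w = b ∧ w.length = a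

theorem exists_leadingZeros_eq {a b : ℕ} (h : a ≤ b) :
    ∃ w : T2, leadingZeros w = a ∧ w.length = b := by
  refine ⟨List.replicate a 0 ++ List.replicate (b - a) 1, ?_, by simp [h]⟩
  rw [leadingZeros, List.takeWhile_append_of_pos (by simp)]
  cases b - a <;> simp [List.replicate_succ]

/-- A node has at most as many leading zeros as its length, so one set codes only pairs with `a ≤
b`; the second set, read with the roles exchanged, supplies the others. -/
theorem exists_codedRel_eq (r : ℕ → ℕ → Prop) : ∃ X Y, codedRel X Y = r := by
  refine ⟨{w | r (leadingZeros w) w.length}, {w | r w.length (leadingZeros w)}, ?_⟩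
  funext a b
  refine propext ⟨?_, fun h => ?_⟩
  · rintro (⟨w, hw, rfl, rfl⟩ | ⟨w, hw, rfl, rfl⟩) <;> exact hw
  · rcases le_total a b with hab | hab <;> obtain ⟨w, rfl, rfl⟩ := exists_leadingZeros_eq hab
    · exact Or.inl ⟨w, h, rfl, rfl⟩
    · exact Or.inr ⟨w, h, rfl, rfl⟩

/-- The predicate on assignments of numbers and binary relations is definable in the tree with
equal level, where nodes stand for their lengths and pairs of sets of nodes for relations. -/
def NatDef (p : (ℕ → ℕ) → (ℕ → ℕ → ℕ → Prop) → Prop) : Prop :=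
  TreeDef fun s S => p (fun i => (s i).length) fun k => codedRel (S (2 * k)) (S (2 * k + 1))

namespace NatDef

theorem congr {p q : (ℕ → ℕ) → (ℕ → ℕ → ℕ → Prop) → Prop} (hp : NatDef p)
    (h : ∀ v R, p v R ↔ q v R) : NatDef q :=
  TreeDef.congr hp fun _ _ => h _ _

theorem not {p : (ℕ → ℕ) → (ℕ → ℕ → ℕ → Prop) → Prop} (hp : NatDef p) :
    NatDef fun v R => ¬ p v R := TreeDef.not hp

theorem and {p q : (ℕ → ℕ) → (ℕ → ℕ → ℕ → Prop) → Prop} (hp : NatDef p) (hq : NatDef q) :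
    NatDef fun v R => p v R ∧ q v R := TreeDef.and hp hq

theorem or {p q : (ℕ → ℕ) → (ℕ → ℕ → ℕ → Prop) → Prop} (hp : NatDef p) (hq : NatDef q) :
    NatDef fun v R => p v R ∨ q v R := TreeDef.or hp hq

theorem imp {p q : (ℕ → ℕ) → (ℕ → ℕ → ℕ → Prop) → Prop} (hp : NatDef p) (hq : NatDef q) :
    NatDef fun v R => p v R → q v R :=
  (hp.not.or hq).congr fun _ _ => by tauto

/-- Every number is the length of some node, so quantifying over nodes is quantifying over numbers.
The condition `hx` expresses that the variable `x` is fresh for `p`. -/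
theorem ex {p : ℕ → (ℕ → ℕ) → (ℕ → ℕ → ℕ → Prop) → Prop} (x : ℕ)
    (hp : NatDef fun v R => p (v x) v R)
    (hx : ∀ n v R, p n (Function.update v x n) R ↔ p n v R) :
    NatDef fun v R => ∃ n, p n v R := by
  refine (TreeDef.exInd x hp).congr fun s S => ?_
  have h (u : T2) : (fun i => (Function.update s x u i).length) =
      Function.update (fun i => (s i).length) x u.length := by
    funext i
    by_cases hi : i = x
    · subst hi; simp
    · simp [hi]
  simp only [h, Function.update_self, hx]
  exact ⟨fun ⟨u, hu⟩ => ⟨_, hu⟩, fun ⟨n, hn⟩ => ⟨List.replicate n 0, by simpa using hn⟩⟩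

theorem all {p : ℕ → (ℕ → ℕ) → (ℕ → ℕ → ℕ → Prop) → Prop} (x : ℕ)
    (hp : NatDef fun v R => p (v x) v R)
    (hx : ∀ n v R, p n (Function.update v x n) R ↔ p n v R) :
    NatDef fun v R => ∀ n, p n v R :=
  (ex (p := fun n v R => ¬ p n v R) x hp.not fun n v R => not_congr (hx n v R)).not.congr fun _ _ => by simp

theorem exRel {p : (ℕ → ℕ → Prop) → (ℕ → ℕ) → Prop} (hp : NatDef fun v R => p (R 0) v) :
    NatDef fun v _ => ∃ r, p r v := by
  refine (TreeDef.exSet 0 (TreeDef.exSet 1 hp)).congr fun s S => ?_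
  simp only [mul_zero, zero_add, Function.update_self, ne_eq, zero_ne_one, not_false_eq_true,
    Function.update_of_ne]
  refine ⟨fun ⟨X, Y, h⟩ => ⟨_, h⟩, fun ⟨r, h⟩ => ?_⟩
  obtain ⟨X, Y, rfl⟩ := exists_codedRel_eq r
  exact ⟨X, Y, h⟩

theorem allRel {p : (ℕ → ℕ → Prop) → (ℕ → ℕ) → Prop} (hp : NatDef fun v R => p (R 0) v) :
    NatDef fun v _ => ∀ r, p r v :=
  (exRel (p := fun r v => ¬ p r v) hp.not).not.congr fun _ _ => by simp

theorem eq (i j : ℕ) : NatDef fun v _ => v i = v j := TreeDef.sameLevel i j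

theorem rel (i j : ℕ) : NatDef fun v R => R 0 (v i) (v j) := by
  have h (i j X : ℕ) : TreeDef fun s S =>
      ∃ w ∈ S X, leadingZeros w = (s i).length ∧ w.length = (s j).length := by
    refine (TreeDef.exInd (i + j + 1) <| (TreeDef.mem (i + j + 1) X).and <|
      (TreeDef.leadingZeros i (i + j + 1)).and (TreeDef.sameLevel (i + j + 1) j)).congr
      fun s S => ?_
    simp (disch := omega) only [Function.update_self, Function.update_of_ne]
  exact (h i j 0).or (h j i 1)

theorem succ (i j : ℕ) : NatDef fun v _ => v j = v i + 1 := by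
  have h := TreeDef.exInd (i + j + 1) <| (TreeDef.parent i (i + j + 1)).and
    (TreeDef.sameLevel (i + j + 1) j)
  refine h.congr fun s S => ?_
  simp (disch := omega) only [Function.update_self, Function.update_of_ne]
  constructor
  · rintro ⟨u, ⟨k, rfl⟩, h⟩
    simpa using h.symm
  · intro h
    exact ⟨s i ++ [0], ⟨0, rfl⟩, by simpa using h.symm⟩

theorem zero (i : ℕ) : NatDef fun v _ => v i = 0 := by
  refine (ex (i + 1) (p := fun n v _ => v i = n + 1) (succ (i + 1) i)
    fun n v R => ?_).not.congr fun v R => ?_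
  · simp
  · cases v i <;> simp

/-- Binary relations given by recursion are definable. -/
theorem recursion {Q : ℕ → ℕ → Prop} {T : ℕ → ℕ → ℕ → ℕ → Prop}
    (hQ : ∀ i j, NatDef fun v _ => Q (v i) (v j))
    (hT : ∀ i j k l, NatDef fun v _ => T (v i) (v j) (v k) (v l))
    {G : ℕ → ℕ → ℕ → Prop} (h0 : ∀ a z, G a 0 z ↔ Q a z)
    (hs : ∀ a n z, G a (n + 1) z ↔ ∃ y, G a n y ∧ T a n y z) (i j k : ℕ) :
    NatDef fun v _ => G (v i) (v j) (v k) := by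
  -- For fixed `a`, the relation is the least one containing the base case and closed under the
  -- step. Zero and successor are spelled out as equations because the definable atoms apply only to
  -- variables.
  have hG (a n z) : G a n z ↔ ∀ r : ℕ → ℕ → Prop,
      ((∀ o, o = 0 → ∀ y, Q a y → r o y) ∧
        ∀ m y m' y', r m y → T a m y y' → m' = m + 1 → r m' y') → r n z := by
    constructor
    · rintro h r ⟨hr, hr'⟩
      induction n generalizing z with
      | zero => exact hr _ rfl z ((h0 a z).1 h)
      | succ n ih =>
        obtain ⟨y, hy, ht⟩ := (hs a n z).1 h
        exact hr' n y _ z (ih y hy) ht rfl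
    · intro h
      refine h (G a) ⟨?_, ?_⟩
      · rintro _ rfl y hy
        exact (h0 a y).2 hy
      · rintro m y _ y' hy ht rfl
        exact (hs a m y').2 ⟨y, hy, ht⟩
  simp only [hG]
  obtain ⟨w, hw⟩ : ∃ w, w = i + j + k := ⟨_, rfl⟩
  refine allRel (imp (and ?_ ?_) (rel j k))
  · refine all (w + 1) (imp (zero _) (all (w + 2) (imp (hQ i (w + 2)) (rel (w + 1) (w + 2))) ?_)) ?_
    all_goals intros; simp (disch := omega) only [Function.update_of_ne]
  · refine all (w + 1) (all (w + 2) (all (w + 3) (all (w + 4)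
      (imp (rel (w + 1) (w + 2)) (imp (hT i (w + 1) (w + 2) (w + 4))
        (imp (succ (w + 1) (w + 3)) (rel (w + 3) (w + 4))))) ?_) ?_) ?_) ?_
    all_goals intros; simp (disch := omega) only [Function.update_of_ne]

/-! ### Arithmetic, pairing and partial recursive functions. -/

theorem add (i j k : ℕ) : NatDef fun v _ => v i + v j = v k := by
  refine recursion (Q := fun a z => a = z) (T := fun _ _ y z => z = y + 1)
    (G := fun a n z => a + n = z) eq (fun _ _ k l => succ k l) ?_ ?_ i j k
  · simp
  · intro a n z
    simp only [exists_eq_left', ← add_assoc]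
    exact eq_comm

theorem mul (i j k : ℕ) : NatDef fun v _ => v i * v j = v k := by
  refine recursion (Q := fun _ z => z = 0) (T := fun a _ y z => y + a = z)
    (G := fun a n z => a * n = z) (fun _ j => zero j) (fun i _ k l => add k i l) ?_ ?_ i j k
  · simp [eq_comm]
  · intro a n z
    simp [mul_add]

theorem lt (i j : ℕ) : NatDef fun v _ => v i < v j := by
  refine (ex (i + j + 1) (p := fun n v _ => v i + n = v j ∧ ¬ n = 0)
    ((add i _ j).and (zero _).not) fun n v R => ?_).congr fun v R => ?_
  · simp (disch := omega) only [Function.update_of_ne]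
  · exact ⟨fun ⟨n, h, hn⟩ => by omega, fun h => ⟨v j - v i, by omega, by omega⟩⟩

theorem pair (i j k : ℕ) : NatDef fun v _ => Nat.pair (v i) (v j) = v k := by
  obtain ⟨w, hw⟩ : ∃ w, w = i + j + k := ⟨_, rfl⟩
  have h₁ : NatDef fun v _ => ∃ n, v j * v j = n ∧ n + v i = v k := by
    refine ex (w + 1) ((mul j j _).and (add _ i k)) ?_
    intros; simp (disch := omega) only [Function.update_of_ne]
  have h₂ : NatDef fun v _ => ∃ n, v i * v i = n ∧ ∃ m, n + v i = m ∧ m + v j = v k := by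
    refine ex (w + 1) ((mul i i _).and (ex (w + 2) ((add _ i _).and (add _ j k)) ?_)) ?_
    all_goals intros; simp (disch := omega) only [Function.update_of_ne]
  refine (((lt i j).and h₁).or ((lt i j).not.and h₂)).congr fun v R => ?_
  simp only [exists_eq_left', Nat.pair]
  split_ifs with h <;> simp [h]

/-- Graphs of partial recursive functions are definable. -/
theorem mem_partrec {f : ℕ →. ℕ} (hf : Nat.Partrec f) (i j : ℕ) :
    NatDef fun v _ => v j ∈ f (v i) := by
  induction hf generalizing i j with
  | zero => exact (zero j).congr fun v R => by simp [pure, PFun.pure]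
  | succ => exact (succ i j).congr fun v R => by simp
  | left =>
    refine (ex (i + j + 1) (p := fun n v _ => Nat.pair (v j) n = v i) (pair j _ i) ?_).congr ?_
    · intros; simp (disch := omega) only [Function.update_of_ne]
    · intro v R
      simp only [PFun.coe_val, Part.mem_some_iff]
      exact ⟨fun ⟨n, h⟩ => by simp [← h], fun h => ⟨(v i).unpair.2, by simp [h]⟩⟩
  | right =>
    refine (ex (i + j + 1) (p := fun n v _ => Nat.pair n (v j) = v i) (pair _ j i) ?_).congr ?_
    · intros; simp (disch := omega) only [Function.update_of_ne]
    · intro v R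
      simp only [PFun.coe_val, Part.mem_some_iff]
      exact ⟨fun ⟨n, h⟩ => by simp [← h], fun h => ⟨(v i).unpair.1, by simp [h]⟩⟩
  | @pair f g _ _ ihf ihg =>
    have h : NatDef fun v _ => ∃ a, a ∈ f (v i) ∧ ∃ b, b ∈ g (v i) ∧ Nat.pair a b = v j := by
      refine ex (i + j + 1) ((ihf i _).and (ex (i + j + 2) ((ihg i _).and (pair _ _ j)) ?_)) ?_
      all_goals intros; simp (disch := omega) only [Function.update_of_ne]
    refine h.congr fun v R => ?_
    simp [Seq.seq]
  | @comp f g _ _ ihf ihg =>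
    have h : NatDef fun v _ => ∃ a, a ∈ g (v i) ∧ v j ∈ f a := by
      refine ex (i + j + 1) ((ihg i _).and (ihf _ j)) ?_
      intros; simp (disch := omega) only [Function.update_of_ne]
    exact h.congr fun v R => Part.mem_bind_iff.symm
  | @prec f g _ _ ihf ihg =>
    have hT (i j k l : ℕ) : NatDef fun v _ => ∃ c, Nat.pair (v j) (v k) = c ∧
        ∃ d, Nat.pair (v i) c = d ∧ v l ∈ g d := by
      refine ex (i + j + k + l + 1) ((pair j k _).and
        (ex (i + j + k + l + 2) ((pair i _ _).and (ihg _ l)) ?_)) ?_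
      all_goals intros; simp (disch := omega) only [Function.update_of_ne]
    have hrec := recursion (T := fun a m y z => ∃ c, Nat.pair m y = c ∧
      ∃ d, Nat.pair a c = d ∧ z ∈ g d) (fun i j => ihf i j) hT (G := fun a n z =>
      z ∈ (Nat.rec (f a) (fun y IH => IH.bind fun i => g (Nat.pair a (Nat.pair y i))) n : Part ℕ))
      (fun _ _ => Iff.rfl) (fun a n z => by simp)
    have h : NatDef fun v _ => ∃ a, ∃ n, Nat.pair a n = v i ∧
        v j ∈ (Nat.rec (f a) (fun y IH => IH.bind fun i => g (Nat.pair a (Nat.pair y i))) n :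
          Part ℕ) := by
      refine ex (i + j + 1) (ex (i + j + 2) ((pair _ _ i).and (hrec _ _ j)) ?_) ?_
      all_goals intros; simp (disch := omega) only [Function.update_of_ne]
    refine h.congr fun v R => ⟨?_, fun h => ?_⟩
    · rintro ⟨a, n, h, hv⟩
      simpa [Nat.unpaired, ← h] using hv
    · exact ⟨(v i).unpair.1, (v i).unpair.2, by simp, by simpa [Nat.unpaired] using h⟩
  | @rfind f _ ihf =>
    -- Unbounded search: value 0 at the result, and a defined nonzero value at every smaller
    -- argument.
    have h : NatDef fun v _ => (∃ c, Nat.pair (v i) (v j) = c ∧ ∃ z, z = 0 ∧ z ∈ f c) ∧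
        ∀ m, m < v j → ∃ c, Nat.pair (v i) m = c ∧ ∃ y, ¬ y = 0 ∧ y ∈ f c := by
      refine and ?_ ?_
      · refine ex (i + j + 1) ((pair i j _).and
          (ex (i + j + 2) ((zero _).and (ihf _ _)) ?_)) ?_
        all_goals intros; simp (disch := omega) only [Function.update_of_ne]
      · refine all (i + j + 1) ((lt _ j).imp (ex (i + j + 2) ((pair i _ _).and
          (ex (i + j + 3) ((zero _).not.and (ihf _ _)) ?_)) ?_)) ?_
        all_goals intros; simp (disch := omega) only [Function.update_of_ne]
    refine h.congr fun v R => ?_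
    refine Iff.trans ?_ Nat.mem_rfind.symm
    simp [and_comm]

end NatDef


/-! ### Undecidability of S2S+CI -/

/-- Children of `CI`-related nodes are related, and no node is related to a proper ancestor. -/
def levelAxiom : LCI :=
  (((Formula.rel () (.var 0) (.var 1)).and <| (Formula.parent (.var 0) (.var 2)).and <|
    (Formula.parent (.var 1) (.var 3)).and (Formula.rel () (.var 2) (.var 3)).neg).exInd 3
    |>.exInd 2 |>.exInd 1 |>.exInd 0).neg.and
  (((Formula.rel () (.var 0) (.var 1)).and (Formula.pdom (.var 0) (.var 1))).exInd 1 |>.exInd 0).neg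

/-- Starting from reflexivity at the root, the first clause relates all nodes of equal length. If a
longer `v` were related to `u`, then so would be its prefix of length `u.length`, and by
transitivity `v` would be related to a proper ancestor, against the second clause. -/
theorem sat_levelAxiom_iff {CI : T2 → T2 → Prop} (hCI : Equivalence CI) (s : ℕ → T2)
    (S : ℕ → Set T2) : levelAxiom.Sat (treeCI CI) s S ↔ CI = fun u v => u.length = v.length := by
  have : levelAxiom.Sat (treeCI CI) s S ↔
      (∀ u v (i j : Fin 2), CI u v → CI (u ++ [i]) (v ++ [j])) ∧ ∀ u w, CI u (u ++ w) → w = [] := by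
    simp only [levelAxiom, Formula.pdom, Formula.Sat, Term.val, treeCI, treeModel]
    refine and_congr ?_ ?_
    · simp only [ne_eq, Function.update_self, zero_ne_one,
        not_false_eq_true, Function.update_of_ne, Nat.reduceEqDiff, OfNat.zero_ne_ofNat,
        OfNat.one_ne_ofNat]
      refine ⟨fun h u v i j huv => by_contra fun hn => h ⟨u, v, _, _, huv, ⟨i, rfl⟩, ⟨j, rfl⟩, hn⟩,
        ?_⟩
      rintro h ⟨u, v, _, _, huv, ⟨i, rfl⟩, ⟨j, rfl⟩, hn⟩
      exact hn (h u v i j huv)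
    · simp only [ne_eq, Function.update_self, zero_ne_one, not_false_eq_true, Function.update_of_ne]
      refine ⟨fun h u w huw => by_contra fun hn => h ⟨u, _, huw, ⟨w, rfl⟩, ?_⟩, ?_⟩
      · simpa using hn
      · rintro h ⟨u, _, huw, ⟨w, rfl⟩, hn⟩
        exact hn (by simp [h u w huw])
  rw [this]
  constructor
  · rintro ⟨h₁, h₂⟩
    have h₃ (n : ℕ) : ∀ u v : T2, u.length = n → v.length = n → CI u v := by
      induction n with
      | zero =>
        intro u v hu hv
        rw [List.length_eq_zero_iff.1 hu, List.length_eq_zero_iff.1 hv]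
        exact hCI.refl _
      | succ n ih =>
        intro u v hu hv
        rcases List.eq_nil_or_concat' u with rfl | ⟨u, i, rfl⟩
        · simp at hu
        rcases List.eq_nil_or_concat' v with rfl | ⟨v, j, rfl⟩
        · simp at hv
        exact h₁ _ _ _ _ (ih u v (by simpa using hu) (by simpa using hv))
    have h₄ (u v : T2) (h : u.length ≤ v.length) (huv : CI u v) : u.length = v.length := by
      have := h₃ _ u (v.take u.length) rfl (by simp [h])
      have h₅ := h₂ (v.take u.length) (v.drop u.length)
        (by simpa using hCI.trans (hCI.symm this) huv)
      have := congrArg List.length h₅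
      simp at this
      omega
    funext u v
    refine propext ⟨fun h => ?_, fun h => h₃ _ u v rfl h.symm⟩
    rcases le_total u.length v.length with hl | hl
    · exact h₄ u v hl h
    · exact (h₄ v u hl (hCI.symm h)).symm
  · rintro rfl
    exact ⟨by simp, by simp⟩

/-! ### Translating instances into sentences. -/

namespace Formula

/-- `shift φ n` says that `φ` holds of a node `n` levels below `x₀`. -/
def shift (φ : LCI) : ℕ → LCI
  | 0 => φ
  | n + 1 =>
    -- Move to a child `x₁`, then rebind `x₀` to it; two variables suffice at every depth.
    ((parent (.var 0) (.var 1)).and (((eq (.var 0) (.var 1)).and (shift φ n)).exInd 0)).exInd 1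

/-- In the tree with equal level, `φ` holds of the nodes of length `n`. -/
def atLevel (φ : LCI) (n : ℕ) : LCI :=
  -- The node without a parent is the root, so `shift` starts from level 0.
  imp levelAxiom (exInd 0 (((parent (.var 1) (.var 0)).exInd 1).neg.and (shift φ n)))

theorem freeSet_shift {φ : LCI} (h : φ.freeSet = ∅) (n : ℕ) : (shift φ n).freeSet = ∅ := by
  induction n with
  | zero => exact h
  | succ n ih => simp [shift, freeSet, ih]

theorem freeInd_shift {φ : LCI} (h : φ.freeInd ⊆ {0}) (n : ℕ) : (shift φ n).freeInd ⊆ {0} := by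
  induction n with
  | zero => exact h
  | succ n ih =>
    intro x hx
    have := @ih x
    simp [shift, freeInd, Term.vars] at hx this ⊢
    tauto

theorem isSentence_atLevel {φ : LCI} (h₁ : φ.freeInd ⊆ {0}) (h₂ : φ.freeSet = ∅) (n : ℕ) :
    (atLevel φ n).IsSentence := by
  refine ⟨Set.eq_empty_of_forall_notMem fun x hx => ?_, ?_⟩
  · have := @freeInd_shift φ h₁ n x
    simp [atLevel, levelAxiom, imp, pdom, freeInd, Term.vars] at hx this
    tauto
  · simp [atLevel, levelAxiom, imp, pdom, freeSet, freeSet_shift h₂]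

theorem sat_shift_iff {φ : LCI} {D : ℕ → Prop}
    (h : ∀ s S, φ.Sat levelModel s S ↔ D (s 0).length) (n : ℕ) (s : ℕ → T2) (S : ℕ → Set T2) :
    (shift φ n).Sat levelModel s S ↔ D ((s 0).length + n) := by
  induction n generalizing s with
  | zero => exact h s S
  | succ n ih =>
    have : (shift φ (n + 1)).Sat levelModel s S ↔
        ∃ u, (∃ i : Fin 2, u = s 0 ++ [i]) ∧ ∃ w, w = u ∧ D (w.length + n) := by
      simp only [shift, Sat, ih]
      simp [Term.val, levelModel, treeCI, treeModel]
    rw [this]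
    simp [add_assoc, add_comm 1 n]

/-- Under any relation other than equal length the antecedent `levelAxiom` fails, so validity over
all equivalence relations reduces to truth in `levelModel`. -/
theorem sat_atLevel_iff {φ : LCI} {D : ℕ → Prop}
    (h : ∀ s S, φ.Sat levelModel s S ↔ D (s 0).length) (n : ℕ) :
    (∀ CI : T2 → T2 → Prop, Equivalence CI → ∀ s S, (atLevel φ n).Sat (treeCI CI) s S) ↔ D n := by
  have key (s S) : (exInd 0 (((parent (.var 1) (.var 0)).exInd 1).neg.and (shift φ n))).Sat
      levelModel s S ↔ D n := by
    have : (exInd 0 (((parent (.var 1) (.var 0)).exInd 1).neg.and (shift φ n))).Sat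
        levelModel s S ↔ ∃ u : T2, (¬ ∃ w : T2, ∃ i : Fin 2, u = w ++ [i]) ∧ D (u.length + n) := by
      simp only [Sat, sat_shift_iff h]
      simp [Term.val, levelModel, treeCI, treeModel]
    rw [this]
    constructor
    · rintro ⟨u, hu, hD⟩
      rcases List.eq_nil_or_concat' u with rfl | h
      · simpa using hD
      · exact absurd h hu
    · exact fun hD => ⟨[], by simp, by simpa using hD⟩
  constructor
  · intro hv
    have heq : Equivalence fun u v : T2 => u.length = v.length :=
      ⟨fun _ => rfl, Eq.symm, Eq.trans⟩
    have := hv _ heq (fun _ => []) (fun _ => ∅)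
    rw [← key (fun _ => []) (fun _ => ∅)]
    exact not_not.1 fun hn => this ⟨(sat_levelAxiom_iff heq _ _).2 rfl, hn⟩
  · rintro hD CI hCI s S ⟨h₁, h₂⟩
    obtain rfl := (sat_levelAxiom_iff hCI s S).1 h₁
    exact h₂ ((key s S).2 hD)

/-- `TreeDef` and `NatDef` are semantic and say nothing about which variables the formula contains.
Finiteness allows the superfluous ones to be bound one at a time. -/
theorem finite_freeInd {K P B : Type} (φ : Formula K P B) : φ.freeInd.Finite := by
  have h (t : Term K) : t.vars.Finite := by cases t <;> simp [Term.vars]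
  induction φ <;> simp_all [freeInd, Set.Finite.sdiff]

theorem finite_freeSet {K P B : Type} (φ : Formula K P B) : φ.freeSet.Finite := by
  induction φ <;> simp_all [freeSet, Set.Finite.sdiff]

/-- Free variables on which the truth value does not depend can be removed. -/
theorem exists_closed {K P B U : Type} [Nonempty U] (M : Model K P B U) {φ : Formula K P B}
    {D : U → Prop} (h : ∀ s S, φ.Sat M s S ↔ D (s 0)) :
    ∃ ψ : Formula K P B, ψ.freeInd ⊆ {0} ∧ ψ.freeSet = ∅ ∧ ∀ s S, ψ.Sat M s S ↔ D (s 0) := by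
  have h₁ : ∃ ψ : Formula K P B, ψ.freeInd ⊆ {0} ∧ ∀ s S, ψ.Sat M s S ↔ D (s 0) := by
    suffices ∀ F : Finset ℕ, ∀ φ : Formula K P B, φ.freeInd ⊆ insert 0 ↑F →
        (∀ s S, φ.Sat M s S ↔ D (s 0)) →
        ∃ ψ : Formula K P B, ψ.freeInd ⊆ {0} ∧ ∀ s S, ψ.Sat M s S ↔ D (s 0) from
      this (finite_freeInd φ).toFinset φ (by simp) h
    intro F
    induction F using Finset.induction_on with
    | empty => exact fun φ hφ h => ⟨φ, by simpa using hφ, h⟩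
    | insert x F _ ih =>
      intro φ hφ h
      by_cases hx : x = 0
      · exact ih φ (by simpa [hx] using hφ) h
      -- Binding `x` existentially is harmless: truth depends only on `s 0`, and the universe is
      -- nonempty.
      · refine ih (exInd x φ) (fun y hy => ?_) fun s S => ?_
        · have := hφ hy.1
          have := hy.2
          simp_all
        · simp [Sat, h, Ne.symm hx]
  obtain ⟨φ, hf, h⟩ := h₁
  suffices ∀ F : Finset ℕ, ∀ φ : Formula K P B, φ.freeInd ⊆ {0} → φ.freeSet ⊆ ↑F →
      (∀ s S, φ.Sat M s S ↔ D (s 0)) →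
      ∃ ψ : Formula K P B, ψ.freeInd ⊆ {0} ∧ ψ.freeSet = ∅ ∧ ∀ s S, ψ.Sat M s S ↔ D (s 0) from
    this (finite_freeSet φ).toFinset φ hf (by simp) h
  intro F
  induction F using Finset.induction_on with
  | empty => exact fun φ hf hφ h => ⟨φ, hf, by simpa using hφ, h⟩
  | insert X F _ ih =>
    intro φ hf hφ h
    refine ih (exSet X φ) hf (fun y hy => ?_) fun s S => ?_
    · have := hφ hy.1
      have := hy.2
      simp_all
    · simp [Sat, h]

/-- Each further level wraps the previous code in a fixed nest of pairings, so the code is given by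
primitive recursion on `n`. -/
theorem computable_code_atLevel (φ : LCI) : Computable fun n => (atLevel φ n).code := by
  have pr (c : ℕ) {g : ℕ → ℕ} (hg : Primrec g) : Primrec fun n => Nat.pair c (g n) :=
    Primrec₂.natPair.comp (Primrec.const c) hg
  have pl (c : ℕ) {g : ℕ → ℕ} (hg : Primrec g) : Primrec fun n => Nat.pair (g n) c :=
    Primrec₂.natPair.comp hg (Primrec.const c)
  have hs : Primrec fun n => (shift φ n).code := by
    let step (c : ℕ) : ℕ := Nat.pair 9 (Nat.pair 1 (Nat.pair 8 (Nat.pair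
      (code (parent (.var 0) (.var 1) : LCI)) (Nat.pair 9 (Nat.pair 0 (Nat.pair 8 (Nat.pair
        (code (eq (.var 0) (.var 1) : LCI)) c)))))))
    have hstep : Primrec step :=
      pr _ <| pr _ <| pr _ <| pr _ <| pr _ <| pr _ <| pr _ <| pr _ Primrec.id
    refine (Primrec.nat_rec₁ φ.code (f := fun _ c => step c)
      (hstep.comp₂ Primrec₂.right)).of_eq fun n => ?_
    induction n with
    | zero => rfl
    | succ n ih => exact congrArg step ih
  -- The constants are the constructor tags met on the way down to `shift`: 7 negation, 8
  -- conjunction, 9 individual quantifier, here binding variable 0.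
  exact (pr 7 <| pr 8 <| pr _ <| pr 7 <| pr 9 <| pr 0 <| pr 8 <| pr _ hs).to_comp

end Formula

theorem not_decidableTheory_S2SCI : ¬ DecidableTheory S2SCI := by
  intro hdec
  have hf : Partrec fun n => Nat.Partrec.Code.eval (Denumerable.ofNat Nat.Partrec.Code n) 0 :=
    Nat.Partrec.Code.eval_part.comp (Computable.ofNat _) (Computable.const 0)
  -- The length of `x₀` numbers a program, and the existentially bound `x₁` is its output on input
  -- 0; an output exists exactly when the program halts.
  have hdef := NatDef.ex (p := fun n v _ => n ∈ Nat.Partrec.Code.eval (Denumerable.ofNat _ (v 0)) 0)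
    1 (NatDef.mem_partrec (Partrec.nat_iff.1 hf) 0 1) (by simp)
  obtain ⟨φ, hφ⟩ := hdef
  obtain ⟨ψ, h₁, h₂, hψ⟩ := Formula.exists_closed levelModel (D := fun u =>
    ∃ n, n ∈ Nat.Partrec.Code.eval (Denumerable.ofNat _ u.length) 0) hφ
  refine ComputablePred.halting_problem 0
    (ComputablePred.computable_of_manyOneReducible ⟨fun c => (ψ.atLevel (Encodable.encode c)).code,
      (Formula.computable_code_atLevel ψ).comp Computable.encode, fun c => ?_⟩ hdec)
  rw [Formula.code_injective.mem_set_image, S2SCI, Set.mem_ofPred_eq,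
    Formula.sat_atLevel_iff (D := fun n =>
      ∃ m, m ∈ Nat.Partrec.Code.eval (Denumerable.ofNat _ n) 0) hψ]
  simp [Formula.isSentence_atLevel h₁ h₂, Part.dom_iff_mem]

end MSOTree
theorem mainTheorem3 :
    ¬ MSOTree.DecidableTheory MSOTree.S2SCI ∧
      ∀ (K P : Type) [Countable K] [Countable P], ¬ MSOTree.FreeIndexationDefinable K P :=
  ⟨MSOTree.not_decidableTheory_S2SCI, fun K P _ _ => MSOTree.not_freeIndexationDefinable K P⟩
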